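/- Let $G$ and $H$ be finite simple unlabelled graphs with adjacency matrices $A_G,A_H$. For a graph let $D$ be its diagonal degree matrix, let $L$ be either its combinatorial Laplacian $D-A$ or its normalized Laplacian $I-D^{-1/2}AD^{-1/2}$ (the same choice for both graphs; an isolated vertex contributes the diagonal entry $1$ to the latter), and let $\lambda_{\max}$ be the largest eigenvalue of $L$. The Chebnet supports are $$C^{(1)}=I,\qquad C^{(2)}=\tfrac{2}{\lambda_{\max}}L-I,\qquad C^{(k)}=2C^{(2)}C^{(k-1)}-C^{(k-2)}\quad(k\ge 3)$$ (with $2/\lambda_{\max}$ read as $0$ if $\lambda_{\max}=0$). A Chebnet starts from node features $H^{(0)}$ that depend only on the degree of the node (for instance constant features, or the degree itself), applies finitely many layers $H^{(l+1)}=\sigma_l\big(\sum_{s=1}^{K}C^{(s)}H^{(l)}W^{(l,s)}\big)$ with entrywise activation functions $\sigma_l$ and weight matrices $W^{(l,s)}$, and finally applies a readout, that is, a function of the multiset of the final node representations. It distinguishes $G$ and $H$ if its outputs on $G$ and on $H$ differ. Suppose that $G$ and $H$ are 1-WL equivalent, i.e. colour refinement gives them the same colour histogram in every round. 1. Suppose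 that $G$ and $H$ are non-regular, in the sense that each has a connected component that is not regular, and that their maximum Laplacian eigenvalues differ. Then Chebnet distinguishes $G$ and $H$: for either Laplacian, some one-layer Chebnet with the two supports $C^{(1)},C^{(2)}$, the degree as the only node feature, ReLU activation and sum readout does so. For the normalized Laplacian, moreover, $\mathbf 1^{\top}C^{(2)}_G\mathbf 1\neq\mathbf 1^{\top}C^{(2)}_H\mathbf 1$, so that already the one-layer Chebnet with constant feature $1$, linear activation, second support only and sum readout distinguishes them. 2. Suppose that the maximum Laplacian eigenvalues of $G$ and $H$ agree. Then all Chebnet supports lie in $ML(\mathcal L_1^+)$: for every $k$ there is one expression $e$, built from a square matrix variable by matrix product, transpose, the all-ones column $\mathbf 1$, diagonalization $\mathrm{diag}$ of columns, addition, multiplication by real constants and entrywise functions on columns, such that $e(A_\Gamma)=C^{(k)}_\Gamma$ for every graph $\Gamma$ with this maximum eigenvalue, in particular for $G$ and $H$. No Chebnet distinguishes $G$ and $H$. 3. If $G$ or $H$ is regular, then no Chebnet distinguishes $G$ and $H$. -/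

import Mathlib

universe u

namespace ChebWL

noncomputable section

/-! ### The 1-WL test (colour refinement) on unlabelled graphs -/

/-- Colours available after `t` rounds. A new colour is the pair of the old colour and the multiset
of the colours of the neighbours, so that no information is lost or invented by recolouring. -/
def WLColor : ℕ → Type
  | 0 => Unit
  | t + 1 => WLColor t × Multiset (WLColor t)

/-- The colour of a vertex after `t` rounds; all vertices start with the same colour. -/
def wlColor {V : Type u} [Fintype V] (G : SimpleGraph V) [DecidableRel G.Adj] :
    (t : ℕ) → V → WLColor t
  | 0, _ => ()
  | t + 1, v => (wlColor G t v, (G.neighborFinset v).val.map (wlColor G t))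

/-- Two graphs are 1-WL equivalent if their colour histograms agree after every round. -/
def WLEquivalent {V W : Type u} [Fintype V] [Fintype W]
    (G : SimpleGraph V) [DecidableRel G.Adj] (H : SimpleGraph W) [DecidableRel H.Adj] : Prop :=
  ∀ t : ℕ, (Finset.univ : Finset V).val.map (wlColor G t) =
    (Finset.univ : Finset W).val.map (wlColor H t)

/-! ### Graph Laplacians and Chebyshev supports -/

/-- Which Laplacian is used: `D - A` or `I - D^{-1/2} A D^{-1/2}`. -/
inductive LaplacianKind
  | combinatorial
  | normalized

/-- The graph Laplacian. At an isolated vertex the row of `A` vanishes, so the value that is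
given to `0 ^ (-1/2)` does not matter. -/
def laplacian (κ : LaplacianKind) {V : Type u} [Fintype V] [DecidableEq V]
    (G : SimpleGraph V) [DecidableRel G.Adj] : Matrix V V ℝ :=
  match κ with
  | .combinatorial => G.lapMatrix ℝ
  | .normalized =>
      1 - Matrix.diagonal (fun v => (√(G.degree v : ℝ))⁻¹) * G.adjMatrix ℝ *
        Matrix.diagonal (fun v => (√(G.degree v : ℝ))⁻¹)

/-- The maximum eigenvalue of the (real symmetric) Laplacian. -/
def maxEigenvalue (κ : LaplacianKind) {V : Type u} [Fintype V] [DecidableEq V]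
    (G : SimpleGraph V) [DecidableRel G.Adj] : ℝ :=
  sSup (spectrum ℝ (laplacian κ G))

/-- `2 L / λ_max - I`. -/
def scaledLaplacian (κ : LaplacianKind) {V : Type u} [Fintype V] [DecidableEq V]
    (G : SimpleGraph V) [DecidableRel G.Adj] : Matrix V V ℝ :=
  (2 / maxEigenvalue κ G) • laplacian κ G - 1

/-- The convolution supports, numbered from `0`: `chebSupport κ G k` is `C^(k+1)`, where
`C^(1) = I`, `C^(2) = 2 L / λ_max - I` and `C^(k) = 2 C^(2) C^(k-1) - C^(k-2)` for `k ≥ 3`. -/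
def chebSupport (κ : LaplacianKind) {V : Type u} [Fintype V] [DecidableEq V]
    (G : SimpleGraph V) [DecidableRel G.Adj] : ℕ → Matrix V V ℝ
  | 0 => 1
  | 1 => scaledLaplacian κ G
  | k + 2 => (2 : ℝ) • (scaledLaplacian κ G * chebSupport κ G (k + 1)) - chebSupport κ G k

/-! ### Chebnet -/

/-- One layer: `H ↦ σ (∑ s, C^(s) H W^(s))`, with `σ` applied entrywise. -/
def chebLayer (κ : LaplacianKind) {V : Type u} [Fintype V] [DecidableEq V]
    (G : SimpleGraph V) [DecidableRel G.Adj] {K f g : ℕ} (σ : ℝ → ℝ)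
    (W : Fin K → Matrix (Fin f) (Fin g) ℝ) (H : Matrix V (Fin f) ℝ) : Matrix V (Fin g) ℝ :=
  (∑ s : Fin K, chebSupport κ G s * H * W s).map σ

/-- A stack of layers with `K` supports each, from feature width `f` to feature width `g`; every
layer has its own activation function and its own weights. -/
inductive ChebLayers (K : ℕ) : ℕ → ℕ → Type
  | nil {f : ℕ} : ChebLayers K f f
  | cons {f g h : ℕ} (σ : ℝ → ℝ) (W : Fin K → Matrix (Fin f) (Fin g) ℝ)
      (rest : ChebLayers K g h) : ChebLayers K f h

/-- The node representations computed by a stack of layers. -/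
def ChebLayers.forward (κ : LaplacianKind) {V : Type u} [Fintype V] [DecidableEq V]
    (G : SimpleGraph V) [DecidableRel G.Adj] {K : ℕ} :
    {f g : ℕ} → ChebLayers K f g → Matrix V (Fin f) ℝ → Matrix V (Fin g) ℝ
  | _, _, .nil, H => H
  | _, _, .cons σ W rest, H => rest.forward κ G (chebLayer κ G σ W H)

/-- A Chebnet for unlabelled graphs. The initial features of a node are determined by its degree
(constant features and the degree itself are special cases). The final node representations are
summarized by an arbitrary order-independent readout, which includes whatever fully connected
layers follow it. -/
structure Chebnet where
  numSupports : ℕ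
  inWidth : ℕ
  outWidth : ℕ
  outDim : ℕ
  feature : ℕ → Fin inWidth → ℝ
  layers : ChebLayers numSupports inWidth outWidth
  readout : Multiset (Fin outWidth → ℝ) → Fin outDim → ℝ

/-- The final node representations; row `v` belongs to the node `v`. -/
def Chebnet.nodeRep (N : Chebnet) (κ : LaplacianKind) {V : Type u} [Fintype V] [DecidableEq V]
    (G : SimpleGraph V) [DecidableRel G.Adj] : Matrix V (Fin N.outWidth) ℝ :=
  N.layers.forward κ G (Matrix.of fun v => N.feature (G.degree v))

/-- The output of a Chebnet on a graph. -/
def Chebnet.output (N : Chebnet) (κ : LaplacianKind) {V : Type u} [Fintype V] [DecidableEq V]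
    (G : SimpleGraph V) [DecidableRel G.Adj] : Fin N.outDim → ℝ :=
  N.readout ((Finset.univ : Finset V).val.map fun v => N.nodeRep κ G v)

/-- The Chebnet with a single layer, the two supports `C^(1)` and `C^(2)` with scalar weights
`w 0` and `w 1`, a single input feature `x (deg v)`, activation `σ`, and sum readout. -/
abbrev Chebnet.oneLayer (x : ℕ → ℝ) (σ : ℝ → ℝ) (w : Fin 2 → ℝ) : Chebnet where
  numSupports := 2
  inWidth := 1
  outWidth := 1
  outDim := 1
  feature := fun d _ => x d
  layers := .cons σ (fun s => Matrix.of fun _ _ => w s) .nil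
  readout := Multiset.sum

/-- The ReLU activation. -/
def relu (x : ℝ) : ℝ := max x 0

/-! ### The matrix language `ML(L₁⁺)` -/

/-- The two symbolic sizes: `1` and the number of nodes. -/
inductive Dim
  | one
  | node

/-- The index type that a symbolic size stands for. -/
abbrev Dim.Idx (V : Type u) : Dim → Type u
  | .one => PUnit
  | .node => V

@[reducible] instance Dim.instFintypeIdx (V : Type u) [Fintype V] : (a : Dim) → Fintype (Dim.Idx V a)
  | .one => inferInstanceAs (Fintype PUnit)
  | .node => inferInstanceAs (Fintype V)

@[reducible] instance Dim.instDecidableEqIdx (V : Type u) [DecidableEq V] :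
    (a : Dim) → DecidableEq (Dim.Idx V a)
  | .one => inferInstanceAs (DecidableEq PUnit)
  | .node => inferInstanceAs (DecidableEq V)

/-- Expressions of `ML(L₁⁺)` in one square matrix variable, with operations: matrix product,
transpose, the all-ones column, diagonalization of a column, addition, multiplication by a
scalar, and entrywise functions on columns (in particular on scalars). -/
inductive MLExpr : Dim → Dim → Type
  | var : MLExpr .node .node
  | mul {a b c : Dim} (e₁ : MLExpr a b) (e₂ : MLExpr b c) : MLExpr a c
  | transpose {a b : Dim} (e : MLExpr a b) : MLExpr b a
  | ones (a : Dim) : MLExpr a .one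
  | diag {a : Dim} (e : MLExpr a .one) : MLExpr a a
  | add {a b : Dim} (e₁ e₂ : MLExpr a b) : MLExpr a b
  | smul {a b : Dim} (c : ℝ) (e : MLExpr a b) : MLExpr a b
  | apply {a : Dim} (f : ℝ → ℝ) (e : MLExpr a .one) : MLExpr a .one

/-- The value of an expression when the variable is the matrix `A`. -/
def MLExpr.eval {V : Type u} [Fintype V] [DecidableEq V] (A : Matrix V V ℝ) :
    {a b : Dim} → MLExpr a b → Matrix (Dim.Idx V a) (Dim.Idx V b) ℝ
  | _, _, .var => A
  | _, _, .mul e₁ e₂ => e₁.eval A * e₂.eval A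
  | _, _, .transpose e => (e.eval A).transpose
  | _, _, .ones _ => Matrix.of fun _ _ => 1
  | _, _, .diag e => Matrix.diagonal fun i => e.eval A i PUnit.unit
  | _, _, .add e₁ e₂ => e₁.eval A + e₂.eval A
  | _, _, .smul c e => c • e.eval A
  | _, _, .apply f e => (e.eval A).map f

/-! ### Non-regularity -/

/-- Some connected component of `G` is not regular. For a connected graph this says that `G` is
not regular. -/
def HasNonregularComponent {V : Type u} [Fintype V] (G : SimpleGraph V) [DecidableRel G.Adj] :
    Prop :=
  ∃ u v : V, G.Reachable u v ∧ G.degree u ≠ G.degree v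

end

end ChebWL

/-! Call two vertices related if colour refinement never separates them (`SameColor`). By 1-WL
equivalence this relation contains a bijection between the vertex sets, and the neighbourhoods of
related vertices are matched by it as well. Hence both Laplacians preserve agreement of vectors on
related vertices (`Intertwines`), a property that survives products, linear combinations and
entrywise activations.

The only global quantity in a support is the factor `2 / λ_max`. If it is the same for both graphs,
every layer keeps the representations in agreement and any readout coincides. On regular graphs of
positive degree constants lie in the kernel of `L`, so the factor never acts; edgeless graphs of
equal size have equal `λ_max`.

If the factors differ, it suffices to exhibit a Chebnet whose output is `2 / λ_max * S` up to a
shared summand, with `S` equal on both graphs by 1-WL and nonzero by non-regularity. For the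
normalized Laplacian `S = 1ᵀ L 1` works. This vanishes for `D - A`, so in general `S` is the sum of
the positive parts of `L` applied to the degree vector. -/

namespace ChebWL

open Matrix

/-! ### Matrices that respect a relation between vertex sets -/

section Invariance

variable {V W : Type u}

/-- The vectors `x` and `y` agree on related indices. -/
def Agree {α : Type*} (r : V → W → Prop) (x : V → α) (y : W → α) : Prop :=
  ∀ v w, r v w → x v = y w

theorem Agree.map_eq {α : Type*} {r : V → W → Prop} {x : V → α} {y : W → α} (h : Agree r x y)
    {s : Multiset V} {t : Multiset W} (hst : Multiset.Rel r s t) : s.map x = t.map y := by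
  rw [← Multiset.rel_eq, Multiset.rel_map]
  exact hst.mono fun a _ b _ hab => h a b hab

variable [Fintype V] [Fintype W]

/-- The matrices `P` and `Q` preserve agreement of vectors on related indices. -/
def Intertwines (r : V → W → Prop) (P : Matrix V V ℝ) (Q : Matrix W W ℝ) : Prop :=
  ∀ x y, Agree r x y → Agree r (P *ᵥ x) (Q *ᵥ y)

namespace Intertwines

variable {r : V → W → Prop} {P P' : Matrix V V ℝ} {Q Q' : Matrix W W ℝ}

theorem one [DecidableEq V] [DecidableEq W] :
    Intertwines r (1 : Matrix V V ℝ) (1 : Matrix W W ℝ) := by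
  intro x y h
  simpa using h

theorem sub (h : Intertwines r P Q) (h' : Intertwines r P' Q') :
    Intertwines r (P - P') (Q - Q') := by
  intro x y hxy v w hvw
  simp only [sub_mulVec, Pi.sub_apply, h x y hxy v w hvw, h' x y hxy v w hvw]

theorem smul (c : ℝ) (h : Intertwines r P Q) : Intertwines r (c • P) (c • Q) := by
  intro x y hxy v w hvw
  simp only [smul_mulVec, Pi.smul_apply, h x y hxy v w hvw]

theorem mul (h : Intertwines r P Q) (h' : Intertwines r P' Q') :
    Intertwines r (P * P') (Q * Q') := by
  intro x y hxy
  simpa only [mulVec_mulVec] using h _ _ (h' x y hxy)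

theorem diagonal [DecidableEq V] [DecidableEq W] {a : V → ℝ} {b : W → ℝ} (h : Agree r a b) :
    Intertwines r (Matrix.diagonal a) (Matrix.diagonal b) := by
  intro x y hxy v w hvw
  simp only [mulVec_diagonal, h v w hvw, hxy v w hvw]

theorem mul_apply_eq (h : Intertwines r P Q) {ι : Type*} {X : Matrix V ι ℝ} {Y : Matrix W ι ℝ}
    (hXY : Agree r X Y) : Agree r (P * X) (Q * Y) := by
  intro v w hvw
  funext j
  exact h (fun i => X i j) (fun i => Y i j) (fun a b hab => congrFun (hXY a b hab) j) v w hvw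

end Intertwines

variable [DecidableEq V] [DecidableEq W] {r : V → W → Prop} {κ : LaplacianKind}
  {G : SimpleGraph V} [DecidableRel G.Adj] {H : SimpleGraph W} [DecidableRel H.Adj]

/-- Every support is a polynomial in the scaled Laplacian, so only the latter has to be checked. -/
theorem Intertwines.chebSupport (h : Intertwines r (scaledLaplacian κ G) (scaledLaplacian κ H)) :
    ∀ k, Intertwines r (chebSupport κ G k) (chebSupport κ H k)
  | 0 => .one
  | 1 => h
  | k + 2 => ((h.mul (Intertwines.chebSupport h (k + 1))).smul 2).sub
      (Intertwines.chebSupport h k)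

theorem Agree.chebLayer (h : Intertwines r (scaledLaplacian κ G) (scaledLaplacian κ H))
    {K f g : ℕ} (σ : ℝ → ℝ) (w : Fin K → Matrix (Fin f) (Fin g) ℝ)
    {X : Matrix V (Fin f) ℝ} {Y : Matrix W (Fin f) ℝ} (hXY : Agree r X Y) :
    Agree r (chebLayer κ G σ w X) (chebLayer κ H σ w Y) := by
  intro a b hab
  funext j
  simp only [ChebWL.chebLayer, Matrix.map_apply, Matrix.sum_apply]
  congr 1
  refine Finset.sum_congr rfl fun s _ => ?_
  rw [Matrix.mul_apply, Matrix.mul_apply, (h.chebSupport s).mul_apply_eq hXY a b hab]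

theorem Agree.forward (h : Intertwines r (scaledLaplacian κ G) (scaledLaplacian κ H))
    {K f g : ℕ} (L : ChebLayers K f g) {X : Matrix V (Fin f) ℝ} {Y : Matrix W (Fin f) ℝ}
    (hXY : Agree r X Y) : Agree r (L.forward κ G X) (L.forward κ H Y) := by
  induction L with
  | nil => exact hXY
  | cons σ w rest ih => exact ih (hXY.chebLayer h σ w)

theorem output_eq_of_intertwines
    (h : Intertwines r (scaledLaplacian κ G) (scaledLaplacian κ H))
    (hdeg : ∀ v w, r v w → G.degree v = H.degree w)
    (hr : Multiset.Rel r (Finset.univ : Finset V).val (Finset.univ : Finset W).val)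
    (N : Chebnet) : N.output κ G = N.output κ H := by
  have hX : Agree r (Matrix.of fun v => N.feature (G.degree v))
      (Matrix.of fun w => N.feature (H.degree w)) := by
    intro v w hvw
    funext j
    simp [hdeg v w hvw]
  have := (hX.forward h N.layers).map_eq hr
  exact congrArg N.readout this

omit [DecidableEq V] [DecidableEq W] in
theorem Intertwines.adjMatrix
    (hn : ∀ v w, r v w → Multiset.Rel r (G.neighborFinset v).val (H.neighborFinset w).val) :
    Intertwines r (G.adjMatrix ℝ) (H.adjMatrix ℝ) := by
  intro x y hxy v w hvw
  rw [SimpleGraph.adjMatrix_mulVec_apply, SimpleGraph.adjMatrix_mulVec_apply]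
  exact congrArg Multiset.sum (hxy.map_eq (hn v w hvw))

theorem Intertwines.laplacian (κ : LaplacianKind)
    (hn : ∀ v w, r v w → Multiset.Rel r (G.neighborFinset v).val (H.neighborFinset w).val) :
    Intertwines r (laplacian κ G) (laplacian κ H) := by
  have hdeg : ∀ v w, r v w → G.degree v = H.degree w := fun v w hvw =>
    Multiset.card_eq_card_of_rel (hn v w hvw)
  cases κ with
  | combinatorial =>
    exact (Intertwines.diagonal fun v w hvw => by rw [hdeg v w hvw]).sub (.adjMatrix hn)
  | normalized =>
    have hd : Intertwines r (Matrix.diagonal fun v => (√(G.degree v : ℝ))⁻¹)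
        (Matrix.diagonal fun w => (√(H.degree w : ℝ))⁻¹) :=
      .diagonal fun v w hvw => by rw [hdeg v w hvw]
    exact Intertwines.one.sub ((hd.mul (.adjMatrix hn)).mul hd)

end Invariance

/-! ### The stable colouring -/

section ColourRefinement

variable {V W : Type u} [Fintype V] [Fintype W]
  (G : SimpleGraph V) [DecidableRel G.Adj] (H : SimpleGraph W) [DecidableRel H.Adj]

/-- Colour refinement never separates the vertices `v` and `w`. -/
def SameColor (v : V) (w : W) : Prop :=
  ∀ t, wlColor G t v = wlColor H t w

variable {G H}

theorem wlColor_eq_of_le {v : V} {w : W} {s t : ℕ} (hst : s ≤ t)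
    (h : wlColor G t v = wlColor H t w) : wlColor G s v = wlColor H s w := by
  induction t, hst using Nat.le_induction with
  | base => exact h
  | succ n _ ih => exact ih (congrArg Prod.fst h)

variable (G H) in
-- Each pair of vertices that is ever separated is separated at some round and stays so. Finitely
-- many pairs have a common bound.
theorem exists_stable_round :
    ∃ T, ∀ (v : V) (w : W), wlColor G T v = wlColor H T w → SameColor G H v w := by
  classical
  have hex : ∀ p : V × W, ∃ t, wlColor G t p.1 = wlColor H t p.2 → SameColor G H p.1 p.2 := by
    intro p
    by_contra! hp
    obtain ⟨-, hns⟩ := hp 0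
    exact hns fun t => (hp t).1
  choose τ hτ using hex
  exact ⟨Finset.univ.sup τ, fun v w h =>
    hτ (v, w) (wlColor_eq_of_le (Finset.le_sup (f := τ) (Finset.mem_univ (v, w))) h)⟩

/-- The colour of round `T + 1` records the neighbours' colours of round `T`, which for the stable
round `T` already decide `SameColor`. -/
theorem SameColor.rel_neighborFinset {v : V} {w : W} (h : SameColor G H v w) :
    Multiset.Rel (SameColor G H) (G.neighborFinset v).val (H.neighborFinset w).val := by
  obtain ⟨T, hT⟩ := exists_stable_round G H
  have h1 : (G.neighborFinset v).val.map (wlColor G T) =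
      (H.neighborFinset w).val.map (wlColor H T) := congrArg Prod.snd (h (T + 1))
  rw [← Multiset.rel_eq, Multiset.rel_map] at h1
  exact h1.mono fun a _ b _ hab => hT a b hab

theorem SameColor.degree_eq {v : V} {w : W} (h : SameColor G H v w) :
    G.degree v = H.degree w :=
  Multiset.card_eq_card_of_rel h.rel_neighborFinset

theorem WLEquivalent.rel_univ (h : WLEquivalent G H) :
    Multiset.Rel (SameColor G H) (Finset.univ : Finset V).val (Finset.univ : Finset W).val := by
  obtain ⟨T, hT⟩ := exists_stable_round G H
  have h1 := h T
  rw [← Multiset.rel_eq, Multiset.rel_map] at h1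
  exact h1.mono fun a _ b _ hab => hT a b hab

theorem WLEquivalent.card_eq (h : WLEquivalent G H) : Fintype.card V = Fintype.card W :=
  Multiset.card_eq_card_of_rel h.rel_univ

theorem WLEquivalent.symm (h : WLEquivalent G H) : WLEquivalent H G := fun t => (h t).symm

theorem WLEquivalent.isRegularOfDegree (h : WLEquivalent G H) {d : ℕ}
    (hG : G.IsRegularOfDegree d) : H.IsRegularOfDegree d := by
  intro w
  obtain ⟨v, -, hv⟩ := Multiset.exists_mem_of_rel_of_mem (Multiset.rel_flip.2 h.rel_univ)
    (Finset.mem_univ_val w)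
  exact (SameColor.degree_eq hv).symm.trans (hG v)

variable [DecidableEq V] [DecidableEq W]

variable (G H) in
theorem intertwines_laplacian_sameColor (κ : LaplacianKind) :
    Intertwines (SameColor G H) (laplacian κ G) (laplacian κ H) :=
  .laplacian κ fun _ _ h => h.rel_neighborFinset

theorem WLEquivalent.output_eq_of_maxEigenvalue_eq (h : WLEquivalent G H) {κ : LaplacianKind}
    (hmax : maxEigenvalue κ G = maxEigenvalue κ H) (N : Chebnet) :
    N.output κ G = N.output κ H := by
  refine output_eq_of_intertwines (r := SameColor G H) ?_ (fun _ _ h => h.degree_eq) h.rel_univ N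
  rw [scaledLaplacian, scaledLaplacian, hmax]
  exact ((intertwines_laplacian_sameColor G H κ).smul _).sub .one

end ColourRefinement

/-! ### Regular graphs -/

section Regular

variable {V : Type u} [Fintype V] [DecidableEq V] {G : SimpleGraph V} [DecidableRel G.Adj]

theorem laplacian_combinatorial_mulVec_apply (x : V → ℝ) (v : V) :
    (laplacian .combinatorial G *ᵥ x) v =
      G.degree v * x v - ∑ u ∈ G.neighborFinset v, x u :=
  SimpleGraph.lapMatrix_mulVec_apply G v x

theorem laplacian_normalized_mulVec_apply (x : V → ℝ) (v : V) :
    (laplacian .normalized G *ᵥ x) v =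
      x v - (√(G.degree v : ℝ))⁻¹ *
        ∑ u ∈ G.neighborFinset v, (√(G.degree u : ℝ))⁻¹ * x u := by
  simp only [laplacian, sub_mulVec, one_mulVec, Pi.sub_apply]
  rw [← mulVec_mulVec, ← mulVec_mulVec, mulVec_diagonal, SimpleGraph.adjMatrix_mulVec_apply]
  simp only [mulVec_diagonal]

theorem laplacian_mulVec_const_of_pos_regular (κ : LaplacianKind) {d : ℕ} (hd : d ≠ 0)
    (hG : G.IsRegularOfDegree d) (c : ℝ) : laplacian κ G *ᵥ (fun _ => c) = 0 := by
  have hd0 : (d : ℝ) ≠ 0 := Nat.cast_ne_zero.2 hd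
  have hs : √(d : ℝ) * √(d : ℝ) = d := Real.mul_self_sqrt d.cast_nonneg
  have hs0 : √(d : ℝ) ≠ 0 := fun h0 => hd0 (by rw [← hs, h0, zero_mul])
  funext v
  cases κ with
  | combinatorial =>
    simp [laplacian_combinatorial_mulVec_apply]
  | normalized =>
    rw [laplacian_normalized_mulVec_apply]
    simp only [hG.degree_eq, Finset.sum_const, SimpleGraph.card_neighborFinset_eq_degree,
      nsmul_eq_mul, Pi.zero_apply]
    field_simp
    rw [pow_two, hs]
    ring

omit [DecidableEq V] in
theorem adjMatrix_eq_zero_of_regular_zero (hG : G.IsRegularOfDegree 0) : G.adjMatrix ℝ = 0 := by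
  ext v w
  have : ¬ G.Adj v w := fun h => by
    have := (G.degree_pos_iff_exists_adj v).2 ⟨w, h⟩
    rw [hG v] at this
    exact lt_irrefl _ this
  simp [this]

theorem laplacian_combinatorial_of_regular_zero (hG : G.IsRegularOfDegree 0) :
    laplacian .combinatorial G = 0 := by
  simp [laplacian, SimpleGraph.lapMatrix, SimpleGraph.degMatrix, hG.degree_eq,
    adjMatrix_eq_zero_of_regular_zero hG]

theorem laplacian_normalized_of_regular_zero (hG : G.IsRegularOfDegree 0) :
    laplacian .normalized G = 1 := by
  simp [laplacian, adjMatrix_eq_zero_of_regular_zero hG]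

theorem maxEigenvalue_eq_of_regular_zero {W : Type u} [Fintype W] [DecidableEq W]
    {H : SimpleGraph W} [DecidableRel H.Adj] (κ : LaplacianKind) (hG : G.IsRegularOfDegree 0)
    (hH : H.IsRegularOfDegree 0) (hcard : Fintype.card V = Fintype.card W) :
    maxEigenvalue κ G = maxEigenvalue κ H := by
  cases isEmpty_or_nonempty V with
  | inl hV =>
    have : IsEmpty W := Fintype.card_eq_zero_iff.1 (hcard ▸ Fintype.card_eq_zero)
    simp [maxEigenvalue, spectrum.of_subsingleton]
  | inr hV =>
    have : Nonempty W := Fintype.card_pos_iff.1 (hcard ▸ Fintype.card_pos)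
    cases κ with
    | combinatorial =>
      simp [maxEigenvalue, laplacian_combinatorial_of_regular_zero, hG, hH]
    | normalized =>
      simp [maxEigenvalue, laplacian_normalized_of_regular_zero, hG, hH]

theorem WLEquivalent.output_eq_of_regular {W : Type u} [Fintype W] [DecidableEq W]
    {H : SimpleGraph W} [DecidableRel H.Adj] (h : WLEquivalent G H) {d : ℕ}
    (hG : G.IsRegularOfDegree d) (κ : LaplacianKind) (N : Chebnet) :
    N.output κ G = N.output κ H := by
  have hH := h.isRegularOfDegree hG
  -- For `d = 0` the normalized Laplacian is the identity and does not annihilate constants, so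
  -- equality of the eigenvalues is used instead.
  obtain rfl | hd := eq_or_ne d 0
  · exact h.output_eq_of_maxEigenvalue_eq (maxEigenvalue_eq_of_regular_zero κ hG hH h.card_eq) N
  -- Under the total relation, agreeing vectors are one and the same constant, on which both scaled
  -- Laplacians act as `-1`.
  refine output_eq_of_intertwines (r := fun _ _ => True) ?_
    (fun v w _ => (hG v).trans (hH w).symm) (h.rel_univ.mono fun _ _ _ _ _ => trivial) N
  intro x y hxy v w _
  have hx : x = fun _ => x v := funext fun a => (hxy a w trivial).trans (hxy v w trivial).symm
  have hy : y = fun _ => x v := funext fun b => (hxy v b trivial).symm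
  generalize x v = c at hx hy
  subst hx hy
  simp [scaledLaplacian, sub_mulVec, smul_mulVec,
    laplacian_mulVec_const_of_pos_regular κ hd hG, laplacian_mulVec_const_of_pos_regular κ hd hH]

end Regular

/-! ### Positivity of the Laplacians and effects of non-regularity -/

section Spectrum

variable {V : Type u} [Fintype V] [DecidableEq V] (G : SimpleGraph V) [DecidableRel G.Adj]

/-- Since `(√0)⁻¹ = 0`, the diagonal correction is `1` at isolated vertices and `0` elsewhere.
Semidefiniteness thus carries over from `D - A`. -/
theorem laplacian_normalized_eq : laplacian .normalized G =
    Matrix.diagonal (fun v => (√(G.degree v : ℝ))⁻¹) * G.lapMatrix ℝ *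
        Matrix.diagonal (fun v => (√(G.degree v : ℝ))⁻¹) +
      Matrix.diagonal (fun v => 1 - (√(G.degree v : ℝ))⁻¹ * G.degree v *
        (√(G.degree v : ℝ))⁻¹) := by
  rw [SimpleGraph.lapMatrix, SimpleGraph.degMatrix, Matrix.mul_sub, Matrix.sub_mul,
    Matrix.diagonal_mul_diagonal, Matrix.diagonal_mul_diagonal, laplacian, sub_add_eq_add_sub,
    Matrix.diagonal_add]
  simp

theorem inv_sqrt_mul_mul_inv_sqrt_le_one (d : ℝ) : (√d)⁻¹ * d * (√d)⁻¹ ≤ 1 := by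
  rcases le_or_gt d 0 with hd | hd
  · simp [Real.sqrt_eq_zero_of_nonpos hd]
  · have hs : √d ≠ 0 := (Real.sqrt_pos.2 hd).ne'
    have h2 : √d * √d = d := Real.mul_self_sqrt hd.le
    refine le_of_eq ?_
    field_simp
    rw [pow_two, h2]

theorem posSemidef_laplacian (κ : LaplacianKind) : (laplacian κ G).PosSemidef := by
  cases κ with
  | combinatorial => exact G.posSemidef_lapMatrix ℝ
  | normalized =>
    rw [laplacian_normalized_eq]
    refine Matrix.PosSemidef.add ?_ (.diagonal fun v => sub_nonneg.2
      (inv_sqrt_mul_mul_inv_sqrt_le_one _))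
    simpa using (G.posSemidef_lapMatrix ℝ).mul_mul_conjTranspose_same
      (Matrix.diagonal (fun v => (√(G.degree v : ℝ))⁻¹))

theorem maxEigenvalue_nonneg (κ : LaplacianKind) : 0 ≤ maxEigenvalue κ G :=
  Real.sSup_nonneg fun _ hx =>
    (Matrix.posSemidef_iff_isHermitian_and_spectrum_nonneg.1 (posSemidef_laplacian G κ)).2 hx

variable {G}

theorem HasNonregularComponent.sum_laplacian_normalized_pos (h : HasNonregularComponent G) :
    0 < ∑ v, (laplacian .normalized G *ᵥ 1) v := by
  obtain ⟨u, v, huv, hne⟩ := h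
  set a : V → ℝ := fun v => (√(G.degree v : ℝ))⁻¹ with ha
  have hsum : ∑ v, (laplacian .normalized G *ᵥ 1) v =
      a ⬝ᵥ (G.lapMatrix ℝ *ᵥ a) + ∑ v, (1 - a v * G.degree v * a v) := by
    rw [laplacian_normalized_eq, add_mulVec, ← mulVec_mulVec, ← mulVec_mulVec]
    simp only [Pi.add_apply, mulVec_diagonal, Finset.sum_add_distrib, Pi.one_apply, mul_one]
    have h1 : Matrix.diagonal a *ᵥ 1 = a := by
      funext i
      simp [mulVec_diagonal]
    rw [← ha, h1]
    rfl
  have hpos : 0 < a ⬝ᵥ (G.lapMatrix ℝ *ᵥ a) := by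
    -- The form of `D - A` vanishes only on vectors constant on components; for `a = d^(-1/2)` this
    -- would make the degree constant there.
    refine lt_of_le_of_ne ((G.posSemidef_lapMatrix ℝ).dotProduct_mulVec_nonneg a) fun h0 => hne ?_
    have h1 := (G.lapMatrix_toLinearMap₂'_apply'_eq_zero_iff_forall_reachable a).1
      ((Matrix.toLinearMap₂'_apply' _ _ _).trans h0.symm) u v huv
    have h2 := inv_injective h1
    rw [Real.sqrt_inj (Nat.cast_nonneg _) (Nat.cast_nonneg _)] at h2
    exact_mod_cast h2
  rw [hsum]
  exact add_pos_of_pos_of_nonneg hpos (Finset.sum_nonneg fun v _ => sub_nonneg.2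
      (inv_sqrt_mul_mul_inv_sqrt_le_one _))

/-- Otherwise the maximum degree of the non-regular component would spread along edges to all of it.
-/
theorem HasNonregularComponent.exists_degree_lt (h : HasNonregularComponent G) :
    ∃ v, (∀ u, G.Adj v u → G.degree u ≤ G.degree v) ∧ ∃ u, G.Adj v u ∧ G.degree u < G.degree v := by
  classical
  obtain ⟨a, b, hab, hne⟩ := h
  obtain ⟨m, hm, hmax⟩ := Finset.exists_max_image (Finset.univ.filter (G.Reachable a))
    (fun v => G.degree v)
    ⟨a, by simp⟩
  simp only [Finset.mem_filter, Finset.mem_univ, true_and] at hm hmax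
  by_contra! hcon
  have key : ∀ y, G.Reachable m y → G.degree y = G.degree m := by
    rintro y hy
    rw [SimpleGraph.reachable_iff_reflTransGen] at hy
    induction hy with
    | refl => rfl
    | @tail y z hy hyz ih =>
      have hr : G.Reachable a y := hm.trans ((SimpleGraph.reachable_iff_reflTransGen _ _).2 hy)
      refine le_antisymm (hmax z (hr.trans hyz.reachable)) ?_
      rw [← ih]
      -- By induction `y` has the maximum degree too, so `hcon` forbids a drop from `y` to `z`.
      refine hcon y (fun u hu => ?_) z hyz
      rw [ih]
      exact hmax u (hr.trans hu.reachable)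
  exact hne ((key a hm.symm).trans (key b (hm.symm.trans hab)).symm)

theorem HasNonregularComponent.exists_laplacian_mulVec_degree_pos (h : HasNonregularComponent G)
    (κ : LaplacianKind) : ∃ v, 0 < (laplacian κ G *ᵥ fun v => (G.degree v : ℝ)) v := by
  obtain ⟨v, hle, u, hu, hlt⟩ := h.exists_degree_lt
  have hmem : u ∈ G.neighborFinset v := by simpa using hu
  have hd : (0 : ℝ) < G.degree v := by exact_mod_cast (Nat.zero_le _).trans_lt hlt
  refine ⟨v, ?_⟩
  cases κ with
  | combinatorial =>
    rw [laplacian_combinatorial_mulVec_apply, sub_pos]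
    calc ∑ u ∈ G.neighborFinset v, (G.degree u : ℝ)
        < ∑ _u ∈ G.neighborFinset v, (G.degree v : ℝ) :=
          Finset.sum_lt_sum (fun w hw => by exact_mod_cast hle w (by simpa using hw))
            ⟨u, hmem, by exact_mod_cast hlt⟩
      _ = G.degree v * G.degree v := by simp
  | normalized =>
    have hs : 0 < √(G.degree v : ℝ) := Real.sqrt_pos.2 hd
    rw [laplacian_normalized_mulVec_apply, sub_pos, inv_mul_lt_iff₀ hs]
    calc ∑ u ∈ G.neighborFinset v, (√(G.degree u : ℝ))⁻¹ * G.degree u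
        = ∑ u ∈ G.neighborFinset v, √(G.degree u : ℝ) :=
          Finset.sum_congr rfl fun w _ => by rw [mul_comm, ← div_eq_mul_inv, Real.div_sqrt]
      _ < ∑ _u ∈ G.neighborFinset v, √(G.degree v : ℝ) :=
          Finset.sum_lt_sum
            (fun w hw => Real.sqrt_le_sqrt (by exact_mod_cast hle w (by simpa using hw)))
            ⟨u, hmem, Real.sqrt_lt_sqrt (Nat.cast_nonneg _) (by exact_mod_cast hlt)⟩
      _ = √(G.degree v : ℝ) * G.degree v := by simp [mul_comm]

end Spectrum

/-! ### Separation by different maximum eigenvalues -/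

section Separation

variable {V W : Type u} [Fintype V] [DecidableEq V] [Fintype W] [DecidableEq W]
  {G : SimpleGraph V} [DecidableRel G.Adj] {H : SimpleGraph W} [DecidableRel H.Adj]

theorem oneLayer_output_apply (x : ℕ → ℝ) (σ : ℝ → ℝ) (w : Fin 2 → ℝ) (κ : LaplacianKind)
    (G : SimpleGraph V) [DecidableRel G.Adj] (i : Fin 1) :
    (Chebnet.oneLayer x σ w).output κ G i =
      ∑ v, σ (x (G.degree v) * w 0 +
        (chebSupport κ G 1 *ᵥ fun u => x (G.degree u)) v * w 1) := by
  have h : (Chebnet.oneLayer x σ w).output κ G =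
      ∑ v, fun j : Fin 1 => chebLayer κ G σ (fun s => Matrix.of fun _ _ => w s)
        (Matrix.of fun v (_ : Fin 1) => x (G.degree v)) v j := rfl
  rw [h, Finset.sum_apply]
  refine Finset.sum_congr rfl fun v _ => ?_
  simp only [chebLayer, Matrix.map_apply, Fin.sum_univ_two, Matrix.add_apply, Matrix.mul_apply,
    chebSupport, Finset.univ_unique, Finset.sum_singleton, Matrix.of_apply,
    Matrix.one_apply, mulVec, dotProduct]
  simp

omit [DecidableEq V] [DecidableEq W] in
theorem WLEquivalent.sum_eq (h : WLEquivalent G H) {x : V → ℝ} {y : W → ℝ}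
    (hxy : Agree (SameColor G H) x y) : ∑ v, x v = ∑ w, y w :=
  congrArg Multiset.sum (hxy.map_eq h.rel_univ)

/-- Inversion is injective on all of `ℝ` with `0⁻¹ = 0`, so a vanishing eigenvalue needs no separate
case. -/
theorem two_div_mul_ne {a b S : ℝ} (hab : a ≠ b) (hS : S ≠ 0) : 2 / a * S ≠ 2 / b * S := by
  intro h
  have h1 := mul_right_cancel₀ hS h
  rw [div_eq_mul_inv, div_eq_mul_inv] at h1
  exact hab (inv_injective (mul_left_cancel₀ two_ne_zero h1))

theorem sum_scaledLaplacian_mulVec_one (κ : LaplacianKind) (G : SimpleGraph V)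
    [DecidableRel G.Adj] : ∑ v, (scaledLaplacian κ G *ᵥ 1) v =
      2 / maxEigenvalue κ G * ∑ v, (laplacian κ G *ᵥ 1) v - Fintype.card V := by
  simp [scaledLaplacian, sub_mulVec, smul_mulVec, Finset.mul_sum]

theorem WLEquivalent.sum_scaledLaplacian_mulVec_one_ne (h : WLEquivalent G H)
    (hG : HasNonregularComponent G)
    (hmax : maxEigenvalue .normalized G ≠ maxEigenvalue .normalized H) :
    ∑ v, (scaledLaplacian .normalized G *ᵥ 1) v ≠
      ∑ w, (scaledLaplacian .normalized H *ᵥ 1) w := by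
  rw [sum_scaledLaplacian_mulVec_one, sum_scaledLaplacian_mulVec_one, h.card_eq,
    ← h.sum_eq (intertwines_laplacian_sameColor G H .normalized 1 1 fun _ _ _ => rfl)]
  exact fun h' => two_div_mul_ne hmax hG.sum_laplacian_normalized_pos.ne' (sub_left_injective h')

theorem oneLayer_relu_output_apply (κ : LaplacianKind) (G : SimpleGraph V) [DecidableRel G.Adj]
    (i : Fin 1) : (Chebnet.oneLayer (fun d => (d : ℝ)) relu ![1, 1]).output κ G i =
      2 / maxEigenvalue κ G * ∑ v, relu ((laplacian κ G *ᵥ fun v => (G.degree v : ℝ)) v) := by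
  rw [oneLayer_output_apply, Finset.mul_sum]
  refine Finset.sum_congr rfl fun v _ => ?_
  -- With both weights `1` the identity support cancels the `-I` in `C^(2)`; the nonnegative factor
  -- then passes through ReLU.
  have h0 : 0 ≤ 2 / maxEigenvalue κ G := div_nonneg zero_le_two (maxEigenvalue_nonneg G κ)
  simp [chebSupport, scaledLaplacian, sub_mulVec, smul_mulVec, relu, mul_max_of_nonneg _ _ h0]

theorem WLEquivalent.oneLayer_relu_output_ne (h : WLEquivalent G H)
    (hG : HasNonregularComponent G) {κ : LaplacianKind}
    (hmax : maxEigenvalue κ G ≠ maxEigenvalue κ H) :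
    (Chebnet.oneLayer (fun d => (d : ℝ)) relu ![1, 1]).output κ G ≠
      (Chebnet.oneLayer (fun d => (d : ℝ)) relu ![1, 1]).output κ H := by
  intro heq
  have h0 := congrFun heq (0 : Fin 1)
  rw [oneLayer_relu_output_apply, oneLayer_relu_output_apply] at h0
  have hagree : Agree (SameColor G H) (fun v => (G.degree v : ℝ)) (fun w => (H.degree w : ℝ)) :=
    fun v w hvw => congrArg Nat.cast hvw.degree_eq
  have hagree' : Agree (SameColor G H)
      (fun v => relu ((laplacian κ G *ᵥ fun v => (G.degree v : ℝ)) v))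
      (fun w => relu ((laplacian κ H *ᵥ fun w => (H.degree w : ℝ)) w)) :=
    fun v w hvw => congrArg relu (intertwines_laplacian_sameColor G H κ _ _ hagree v w hvw)
  rw [← h.sum_eq hagree'] at h0
  obtain ⟨v, hv⟩ := hG.exists_laplacian_mulVec_degree_pos κ
  exact two_div_mul_ne hmax (Finset.sum_pos' (fun _ _ => le_max_right _ _)
    ⟨v, Finset.mem_univ v, lt_max_of_lt_left hv⟩).ne' h0

end Separation

/-! ### Supports as expressions of the matrix language -/

section MatrixLanguage

variable {V : Type u} [Fintype V] [DecidableEq V] (G : SimpleGraph V) [DecidableRel G.Adj]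

/-- The identity matrix as an expression. -/
def idExpr : MLExpr .node .node := .diag (.ones .node)

/-- The column of row sums, that is, of degrees. -/
def degreeExpr : MLExpr .node .one := .mul .var (.ones .node)

/-- The Laplacian of the graph with the adjacency matrix `A`. -/
noncomputable def laplacianExpr : LaplacianKind → MLExpr .node .node
  | .combinatorial => .add (.diag degreeExpr) (.smul (-1) .var)
  | .normalized =>
      .add idExpr (.smul (-1) (.mul (.mul (.diag (.apply (fun x => (√x)⁻¹) degreeExpr)) .var)
        (.diag (.apply (fun x => (√x)⁻¹) degreeExpr))))

/-- The Chebyshev supports for the maximum eigenvalue `c`. -/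
noncomputable def chebExpr (κ : LaplacianKind) (c : ℝ) : ℕ → MLExpr .node .node
  | 0 => idExpr
  | 1 => .add (.smul (2 / c) (laplacianExpr κ)) (.smul (-1) idExpr)
  | k + 2 => .add
      (.smul 2 (.mul (.add (.smul (2 / c) (laplacianExpr κ)) (.smul (-1) idExpr))
        (chebExpr κ c (k + 1))))
      (.smul (-1) (chebExpr κ c k))

theorem eval_idExpr (A : Matrix V V ℝ) : idExpr.eval A = (1 : Matrix V V ℝ) := by
  ext i j
  simp [idExpr, MLExpr.eval, Matrix.diagonal_apply, Matrix.one_apply]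

theorem eval_degreeExpr (i : V) :
    degreeExpr.eval (G.adjMatrix ℝ) i PUnit.unit = (G.degree i : ℝ) := by
  have h := G.adjMatrix_mulVec_const_apply (α := ℝ) (a := 1) (v := i)
  rw [mul_one] at h
  exact h

theorem eval_laplacianExpr (κ : LaplacianKind) :
    (laplacianExpr κ).eval (G.adjMatrix ℝ) = laplacian κ G := by
  cases κ with
  | combinatorial =>
    simp only [laplacianExpr, MLExpr.eval, eval_degreeExpr, neg_one_smul, ← sub_eq_add_neg]
    rfl
  | normalized =>
    simp only [laplacianExpr, MLExpr.eval, Matrix.map_apply, eval_degreeExpr, eval_idExpr,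
      neg_one_smul, ← sub_eq_add_neg]
    rfl

/-- The eigenvalue enters the expression only as a real constant, so graphs sharing it share the
expression. -/
theorem eval_chebExpr (κ : LaplacianKind) : ∀ k,
    (chebExpr κ (maxEigenvalue κ G) k).eval (G.adjMatrix ℝ) = chebSupport κ G k
  | 0 => eval_idExpr _
  | 1 => by
    simp only [chebExpr, MLExpr.eval, eval_laplacianExpr, eval_idExpr, neg_one_smul,
      ← sub_eq_add_neg]
    rfl
  | k + 2 => by
    simp only [chebExpr, MLExpr.eval, eval_laplacianExpr, eval_idExpr, neg_one_smul,
      ← sub_eq_add_neg, eval_chebExpr κ (k + 1), eval_chebExpr κ k]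
    rfl

end MatrixLanguage

end ChebWL

open ChebWL in
theorem theorem2 {V W : Type u} [Fintype V] [DecidableEq V] [Fintype W] [DecidableEq W]
    (G : SimpleGraph V) [DecidableRel G.Adj] (H : SimpleGraph W) [DecidableRel H.Adj]
    (hGH : WLEquivalent G H) :
    -- different maximum eigenvalues, normalized Laplacian: `1ᵀ C^(2) 1` differs, and a one-layer
    -- Chebnet with constant features and linear activation separates the graphs
    (HasNonregularComponent G → HasNonregularComponent H →
      maxEigenvalue .normalized G ≠ maxEigenvalue .normalized H →
        (1 : V → ℝ) ⬝ᵥ (chebSupport .normalized G 1).mulVec 1 ≠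
            (1 : W → ℝ) ⬝ᵥ (chebSupport .normalized H 1).mulVec 1 ∧
          (Chebnet.oneLayer (fun _ => 1) id ![0, 1]).output .normalized G ≠
            (Chebnet.oneLayer (fun _ => 1) id ![0, 1]).output .normalized H) ∧
    -- different maximum eigenvalues, either Laplacian: a one-layer Chebnet with degree features
    -- and ReLU activation separates the graphs
    (∀ κ : LaplacianKind, HasNonregularComponent G → HasNonregularComponent H →
      maxEigenvalue κ G ≠ maxEigenvalue κ H →
        ∃ w : Fin 2 → ℝ,
          (Chebnet.oneLayer (fun d => (d : ℝ)) relu w).output κ G ≠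
            (Chebnet.oneLayer (fun d => (d : ℝ)) relu w).output κ H) ∧
    -- equal maximum eigenvalues: every support is one expression of `ML(L₁⁺)`, the same for all
    -- graphs with this maximum eigenvalue, and no Chebnet separates the graphs
    (∀ κ : LaplacianKind, maxEigenvalue κ G = maxEigenvalue κ H →
      (∀ k : ℕ, ∃ e : MLExpr .node .node,
        ∀ (X : Type u) [Fintype X] [DecidableEq X] (Γ : SimpleGraph X) [DecidableRel Γ.Adj],
          maxEigenvalue κ Γ = maxEigenvalue κ G →
            e.eval (Γ.adjMatrix ℝ) = chebSupport κ Γ k) ∧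
      ∀ N : Chebnet, N.output κ G = N.output κ H) ∧
    -- a regular graph among the two: no Chebnet separates them either
    (((∃ d : ℕ, G.IsRegularOfDegree d) ∨ ∃ d : ℕ, H.IsRegularOfDegree d) →
      ∀ (κ : LaplacianKind) (N : Chebnet), N.output κ G = N.output κ H) := by
  refine ⟨fun hG _ hmax => ?_, fun κ hG _ hmax => ⟨![1, 1], hGH.oneLayer_relu_output_ne hG hmax⟩,
    fun κ hmax => ⟨fun k => ⟨chebExpr κ (maxEigenvalue κ G) k, fun X _ _ Γ _ hΓ => ?_⟩,
      hGH.output_eq_of_maxEigenvalue_eq hmax⟩, ?_⟩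
  · have hne := hGH.sum_scaledLaplacian_mulVec_one_ne hG hmax
    refine ⟨fun h => hne ?_, fun h => hne ?_⟩
    · rw [one_dotProduct, one_dotProduct] at h
      exact h
    · have h0 := congrFun h (0 : Fin 1)
      rw [oneLayer_output_apply, oneLayer_output_apply] at h0
      simpa [chebSupport, ← Pi.one_def] using h0
  · rw [← hΓ]
    exact eval_chebExpr Γ κ k
  · rintro (⟨d, hd⟩ | ⟨d, hd⟩) κ N
    · exact hGH.output_eq_of_regular hd κ N
    · exact (hGH.symm.output_eq_of_regular hd κ N).symm
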